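/- Let $\mathfrak{R}$ be a reduced crystallographic (finite) root system with a choice of simple roots, positive roots $\mathfrak{R}_+$ and Weyl group $\tilde W$. Let $\Omega$ be a group of twists, i.e. a group of automorphisms of $\mathfrak{R}$ permuting the simple roots, and let $W=\Omega\ltimes\tilde W$ be the corresponding twisted Weyl group, acting on $\mathfrak{R}$. For $w\in W$ let $\mathfrak{R}_w=\{\beta\in\mathfrak{R}_+ : w(\beta)\notin\mathfrak{R}_+\}$ be its inversion set, let $\ell(w)=|\mathfrak{R}_w|$ be its length, and let $\mathfrak{R}^w_{\mathrm{st}}$ be its set of stable roots: those roots whose orbit under the powers $w^n$, $n\in\mathbb{Z}$, consists only of positive roots or only of negative roots. The twisted braid monoid is the monoid generated by the reduced braids $b_w$, $w\in W$, subject to $b_1=1$ and to $b_xb_y=b_{xy}$ whenever $\ell(xy)=\ell(x)+\ell(y)$; it is the semidirect product of $\Omega$ and the positive braid monoid of $\tilde W$. For an element $b$ of it, the right Deligne–Garside factor $\mathrm{DG}(b)$ is the element $u\in\tilde W$ such that $b_u$ is the greatest, with respect to right divisibility, among the reduced braids $b_v$ with $v\in\tilde W$ which divide $b$ on the right. Call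 $w\in W$ convex if the set $\mathfrak{R}_+\setminus\mathfrak{R}^w_{\mathrm{st}}$ is convex, meaning that it contains every root which is the sum of two of its elements; in that case the braid power bound $\mathrm{pb}(w)$ is the unique element of $\tilde W$ with inversion set $\mathfrak{R}_{\mathrm{pb}(w)}=\mathfrak{R}_+\setminus\mathfrak{R}^w_{\mathrm{st}}$. **Corollary A.** Let $w$ be a convex element of a twisted Weyl group and let $d\geq 0$ be an integer. Then \[ \mathrm{DG}(b_w^d)=\mathrm{pb}(w)\qquad\text{if and only if}\qquad \mathrm{DG}(b_{w^{-1}}^d)=\mathrm{pb}(w). \] -/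

import Mathlib

namespace TwistedWeyl

variable {ι K M N : Type*} [Field K] [CharZero K] [AddCommGroup M] [Module K M]
  [AddCommGroup N] [Module K N] {P : RootPairing ι K M N}

/-- The group of all twists: the automorphisms of the root system which permute the simple roots
of the base `b`. -/
def twistGroup (b : P.Base) : Subgroup P.Aut where
  carrier := {g | ∀ i : ι, g • i ∈ b.support ↔ i ∈ b.support}
  one_mem' := fun i => by rw [one_smul]
  mul_mem' := fun {g h} hg hh i => by rw [mul_smul, hg, hh]
  inv_mem' := fun {g} hg i => by rw [← hg (g⁻¹ • i), smul_inv_smul]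

/-- The twisted Weyl group attached to a group `Ω` of twists: the subgroup of automorphisms of the
root system generated by `Ω` and the Weyl group. For `Ω ≤ twistGroup b` it is the internal
semidirect product of `Ω` and the (normal) Weyl group. -/
noncomputable def twistedWeylGroup (P : RootPairing ι K M N) (Ω : Subgroup P.Aut) : Subgroup P.Aut :=
  Ω ⊔ P.weylGroup

/-- The inversion set of `w`: the positive roots `β` such that `w β` is negative (that is, not
positive). Roots are represented by their indices. -/
def inversionSet (b : P.Base) (w : P.Aut) : Set ι :=
  {i | b.IsPos i ∧ ¬ b.IsPos (w • i)}

/-- The length of `w`: the number of its inversions. -/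
noncomputable def length (b : P.Base) (w : P.Aut) : ℕ :=
  (inversionSet b w).ncard

/-- The stable roots of `w`: the roots whose orbit under the powers of `w` consists only of
positive roots, or only of negative roots. -/
def stableRoots (b : P.Base) (w : P.Aut) : Set ι :=
  {i | (∀ n : ℤ, b.IsPos (w ^ n • i)) ∨ (∀ n : ℤ, ¬ b.IsPos (w ^ n • i))}

/-- A set of roots is convex if it contains each root which is a sum of two of its elements. -/
def IsConvexSet (P : RootPairing ι K M N) (S : Set ι) : Prop :=
  ∀ i ∈ S, ∀ j ∈ S, ∀ k : ι, P.root k = P.root i + P.root j → k ∈ S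

/-- The positive roots which are not stable under `w`. -/
def unstablePositiveRoots (b : P.Base) (w : P.Aut) : Set ι :=
  {i | b.IsPos i} \ stableRoots b w

/-- `w` is convex if the set of its unstable positive roots is convex. -/
def IsConvexElement (b : P.Base) (w : P.Aut) : Prop :=
  IsConvexSet P (unstablePositiveRoots b w)

/-- The defining relations of the twisted braid monoid, on the generators `b_w` for `w` in the
twisted Weyl group: `b_x b_y = b_{xy}` if lengths add up, and `b_1 = 1`. -/
inductive BraidRel (b : P.Base) (Ω : Subgroup P.Aut) :
    FreeMonoid (twistedWeylGroup P Ω) → FreeMonoid (twistedWeylGroup P Ω) → Prop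
  | one : BraidRel b Ω (FreeMonoid.of 1) 1
  | mul (x y : twistedWeylGroup P Ω)
      (h : length b ((x * y : twistedWeylGroup P Ω) : P.Aut) =
        length b (x : P.Aut) + length b (y : P.Aut)) :
      BraidRel b Ω (FreeMonoid.of x * FreeMonoid.of y) (FreeMonoid.of (x * y))

/-- The twisted braid monoid, in the presentation whose generators are the reduced braids `b_w`
(Deligne, Michel). The elements `b_s` for simple reflections `s` satisfy the braid relations, the
elements `b_δ` for twists `δ` are invertible and satisfy `b_δ b_s = b_{δ s δ⁻¹} b_δ`, and these
generate, so that this is the semidirect product of `Ω` and the positive Artin-Tits monoid. -/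
abbrev BraidMonoid (b : P.Base) (Ω : Subgroup P.Aut) : Type _ :=
  PresentedMonoid (BraidRel b Ω)

/-- The reduced braid `b_w` of an element `w` of the twisted Weyl group. -/
def reducedBraid (b : P.Base) (Ω : Subgroup P.Aut) (w : twistedWeylGroup P Ω) :
    BraidMonoid b Ω :=
  PresentedMonoid.of (BraidRel b Ω) w

/-- `β` divides `γ` on the right. -/
def RightDivides {B : Type*} [Monoid B] (β γ : B) : Prop :=
  ∃ α : B, γ = α * β

/-- `u` is the right Deligne-Garside factor of the braid `β`: it lies in the untwisted Weyl group,
and `b_u` is the greatest, for right divisibility, of the right divisors of `β` that are reduced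
braids of elements of the untwisted Weyl group. -/
def IsDGFactor (b : P.Base) (Ω : Subgroup P.Aut) (β : BraidMonoid b Ω)
    (u : twistedWeylGroup P Ω) : Prop :=
  (u : P.Aut) ∈ P.weylGroup ∧ RightDivides (reducedBraid b Ω u) β ∧
    ∀ v : twistedWeylGroup P Ω, (v : P.Aut) ∈ P.weylGroup →
      RightDivides (reducedBraid b Ω v) β →
        RightDivides (reducedBraid b Ω v) (reducedBraid b Ω u)

open Classical in
/-- The right Deligne-Garside factor `DG(β)` of a braid `β`. For finite root systems it exists and
is unique, so that the default value is never used. -/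
noncomputable def DG (b : P.Base) (Ω : Subgroup P.Aut) (β : BraidMonoid b Ω) :
    twistedWeylGroup P Ω :=
  if h : ∃ u, IsDGFactor b Ω β u then h.choose else 1

open Classical in
/-- The braid power bound `pb(w)` of a convex element `w`: the element of the untwisted Weyl group
whose inversion set consists of the unstable positive roots of `w`. For convex `w` it exists and
is unique (a set of positive roots which is convex and has convex complement in the positive roots
is an inversion set), so that the default value is never used. -/
noncomputable def pb (b : P.Base) (Ω : Subgroup P.Aut) (w : twistedWeylGroup P Ω) :
    twistedWeylGroup P Ω :=
  if h : ∃ u : twistedWeylGroup P Ω, (u : P.Aut) ∈ P.weylGroup ∧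
      inversionSet b (u : P.Aut) = unstablePositiveRoots b (w : P.Aut)
  then h.choose else 1

end TwistedWeyl

set_option linter.unusedSectionVars false

namespace TwistedWeyl

variable {ι K M N : Type*} [Field K] [CharZero K] [AddCommGroup M] [Module K M]
  [AddCommGroup N] [Module K N] {P : RootPairing ι K M N}

/-! ### Roots and automorphisms -/

/-! Write `N(β)` for the positive roots that are not inversions of the Deligne–Garside factor of
`β`. The set `N(β b_y)` depends only on `N(β)` and `y`: it consists of the positive `i` such that `y
i` is a sum of roots from `N(β)` and the inversions of `y⁻¹`. This rule is `transport`. It respects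
the defining relations (`transport_mul`), so the braid monoid acts on biconvex sets from the right.
Biconvex sets are exactly the inversion sets of Weyl group elements, so the orbit of the full
positive system computes `DG` (`inversionSet_DG`). For convex `w` the condition `DG(b_w^d) = pb(w)`
then says that `d` transports by `w` shrink the positive roots to the stable positive ones
(`DG_eq_pb_iff`).

Stable positive roots always survive transport. What else survives is governed by chains `γ₀, …,
γ_d` of positive roots in which `w γₙ₊₁` arises from `γₙ` by adding inversions of `w⁻¹` one at a
time. Every endpoint `γ_d` lies in the `d`-th iterate, and every root of the iterate is a sum of
endpoints (`iterate_transport_subset`). As the stable positive roots are closed under sums, the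
condition holds exactly when no chain of length `d` ends in an unstable root.

This criterion is symmetric in `w` and `w⁻¹`. Reading a chain backwards gives a chain for `w⁻¹`
(`IsChain.reverse`), and by convexity a chain starting in an unstable root also ends in one
(`IsChain.mem_unstablePositiveRoots`). So a bad chain for one element reverses to a bad chain for
the other. -/

lemma root_smul (g : P.Aut) (i : ι) : P.root (g • i) = g • P.root i :=
  RootPairing.Equiv.root_indexEquiv_eq_smul P i g

lemma root_smul_eq_add (g : P.Aut) {i j k : ι} (h : P.root k = P.root i + P.root j) :
    P.root (g • k) = P.root (g • i) + P.root (g • j) := by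
  simp only [root_smul, h, smul_add]

/-- The index of the negative of a root. -/
def negIdx (P : RootPairing ι K M N) (i : ι) : ι := P.reflectionPerm i i

@[simp] lemma root_negIdx (i : ι) : P.root (negIdx P i) = -P.root i := by
  simp [negIdx, RootPairing.root_reflectionPerm]

@[simp] lemma negIdx_negIdx (i : ι) : negIdx P (negIdx P i) = i :=
  P.root.injective (by simp)

@[simp] lemma smul_negIdx (g : P.Aut) (i : ι) : g • negIdx P i = negIdx P (g • i) :=
  P.root.injective (by simp [root_smul])

@[simp] lemma isPos_negIdx (b : P.Base) (i : ι) : b.IsPos (negIdx P i) ↔ ¬ b.IsPos i :=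
  RootPairing.Base.IsPos.neg_iff_not b i

section Pairing

variable [Finite ι] [P.IsCrystallographic]

lemma pairingIn_add {i j k : ι} (h : P.root k = P.root i + P.root j) (l : ι) :
    P.pairingIn ℤ k l = P.pairingIn ℤ i l + P.pairingIn ℤ j l := by
  apply FaithfulSMul.algebraMap_injective ℤ K
  simp only [map_add, RootPairing.algebraMap_pairingIn, ← RootPairing.root_coroot_eq_pairing, h,
    LinearMap.add_apply]

lemma exists_root_eq_sub {i j : ι} (h : 0 < P.pairingIn ℤ i j) (hij : i ≠ j) :
    ∃ k, P.root k = P.root i - P.root j :=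
  P.root_sub_root_mem_of_pairingIn_pos h hij

/-- Since `k` pairs to `2` with itself, one summand pairs positively with `k`. The sign of a pairing
is symmetric, so the other decomposition of `k` can be expanded in the same way. -/
lemma exists_pairingIn_pos_of_add_eq_add {i j k s t : ι} (h : P.root k = P.root i + P.root j)
    (h' : P.root k = P.root s + P.root t) :
    (0 < P.pairingIn ℤ i s ∨ 0 < P.pairingIn ℤ i t) ∨
      0 < P.pairingIn ℤ j s ∨ 0 < P.pairingIn ℤ j t := by
  have h2 : P.pairingIn ℤ k k = 2 := by simp
  have key (l : ι) (hl : 0 < P.pairingIn ℤ l k) :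
      0 < P.pairingIn ℤ l s ∨ 0 < P.pairingIn ℤ l t := by
    rw [P.zero_lt_pairingIn_iff' ℤ, pairingIn_add h'] at hl
    rw [P.zero_lt_pairingIn_iff' ℤ (i := l) (j := s), P.zero_lt_pairingIn_iff' ℤ (i := l) (j := t)]
    lia
  rw [pairingIn_add h] at h2
  rcases lt_or_ge 0 (P.pairingIn ℤ i k) with hi | hi
  · exact Or.inl (key i hi)
  · exact Or.inr (key j (by lia))

/-- If `x + y` and `x + y + r` are roots, then so is `x + r` or `y + r`. -/
lemma exists_root_eq_add_or {x y r s t : ι} (hxr : P.root x + P.root r ≠ 0)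
    (hyr : P.root y + P.root r ≠ 0)
    (hs : P.root s = P.root x + P.root y) (ht : P.root t = P.root s + P.root r) :
    (∃ k, P.root k = P.root x + P.root r) ∨ ∃ k, P.root k = P.root y + P.root r := by
  by_contra! hcon
  obtain ⟨hx, hy⟩ := hcon
  have key (x : ι) (hxr : P.root x + P.root r ≠ 0)
      (hx : ∀ k, P.root k ≠ P.root x + P.root r) : 0 ≤ P.pairingIn ℤ x r := by
    by_contra! h
    obtain ⟨k, hk⟩ := P.root_add_root_mem_of_pairingIn_neg h
      (fun e => hxr (by rw [e]; exact neg_add_cancel _))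
    exact hx k hk
  have key' (x y : ι) (hyr : P.root y + P.root r ≠ 0) (hs : P.root s = P.root x + P.root y)
      (hy : ∀ k, P.root k ≠ P.root y + P.root r) : P.pairingIn ℤ x t ≤ 0 := by
    by_contra! h
    rw [P.zero_lt_pairingIn_iff' ℤ] at h
    obtain ⟨k, hk⟩ := exists_root_eq_sub h (by
      rintro rfl
      apply hyr
      rw [hs, add_assoc] at ht
      exact left_eq_add.mp ht)
    exact hy k (by rw [hk, ht, hs]; abel)
  -- If neither sum is a root, `x` and `y` pair nonnegatively with `r`; they pair nonpositively with
  -- `t`, because `t - x = y + r` and `t - y = x + r`. Hence `⟨s, r⟩ ≥ 0` and `⟨s, t⟩ ≤ 0`; but `⟨t,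
  -- s⟩ = 2 + ⟨r, s⟩`, which forces `⟨r, s⟩ < 0`.
  have h1 := key x hxr hx
  have h2 := key y hyr hy
  have h3 := key' x y hyr hs hy
  have h4 := key' y x hxr (by rw [hs, add_comm]) hx
  have h5 : P.pairingIn ℤ s t ≤ 0 := by rw [pairingIn_add hs]; lia
  rw [P.pairingIn_le_zero_iff ℤ, pairingIn_add ht] at h5
  have h6 : P.pairingIn ℤ s s = 2 := by simp
  have h7 : 0 ≤ P.pairingIn ℤ s r := by rw [pairingIn_add hs]; lia
  have h8 : P.pairingIn ℤ r s < 0 := by lia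
  rw [P.pairingIn_lt_zero_iff ℤ] at h8
  lia

end Pairing

/-! ### Closure under sums -/

/-- The smallest set of roots which contains `S` and each root that is a sum of two of its
elements. -/
inductive sumClosure (P : RootPairing ι K M N) (S : Set ι) : Set ι
  | base {i : ι} (h : i ∈ S) : sumClosure P S i
  | add {i j k : ι} (hi : sumClosure P S i) (hj : sumClosure P S j)
      (h : P.root k = P.root i + P.root j) : sumClosure P S k

lemma subset_sumClosure (S : Set ι) : S ⊆ sumClosure P S := fun _ h => .base h

lemma isConvexSet_sumClosure (S : Set ι) : IsConvexSet P (sumClosure P S) :=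
  fun _ hi _ hj _ h => .add hi hj h

lemma sumClosure_subset {S T : Set ι} (hT : IsConvexSet P T) (h : S ⊆ T) :
    sumClosure P S ⊆ T := by
  intro i hi
  induction hi with
  | base hi => exact h hi
  | add _ _ e ihi ihj => exact hT _ ihi _ ihj _ e

lemma sumClosure_mono {S T : Set ι} (h : S ⊆ T) : sumClosure P S ⊆ sumClosure P T :=
  sumClosure_subset (isConvexSet_sumClosure T) (h.trans (subset_sumClosure T))

lemma isConvexSet_preimage_smul (g : P.Aut) {S : Set ι} (hS : IsConvexSet P S) :
    IsConvexSet P {i | g • i ∈ S} :=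
  fun _ hi _ hj _ h => hS _ hi _ hj _ (root_smul_eq_add g h)

lemma isConvexSet_isPos (b : P.Base) : IsConvexSet P {i | b.IsPos i} :=
  fun _ hi _ hj _ h => RootPairing.Base.IsPos.add hi hj h

lemma isConvexSet_not_isPos (b : P.Base) : IsConvexSet P {i | ¬ b.IsPos i} := by
  intro i hi j hj k h
  rw [Set.mem_ofPred_eq, ← isPos_negIdx] at *
  exact RootPairing.Base.IsPos.add hi hj (by simp [h, add_comm])

lemma IsConvexSet.inter {S T : Set ι} (hS : IsConvexSet P S) (hT : IsConvexSet P T) :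
    IsConvexSet P (S ∩ T) :=
  fun _ hi _ hj _ h => ⟨hS _ hi.1 _ hj.1 _ h, hT _ hi.2 _ hj.2 _ h⟩

/-- A set of roots is coconvex if a sum of two positive roots lies in it only if one of the
summands does. -/
def IsCoconvexSet (b : P.Base) (S : Set ι) : Prop :=
  ∀ k ∈ S, ∀ i j : ι, b.IsPos i → b.IsPos j → P.root k = P.root i + P.root j → i ∈ S ∨ j ∈ S

/-- A set of positive roots is biconvex if it is convex and coconvex. -/
structure IsBiconvexSet (b : P.Base) (S : Set ι) : Prop where
  isPos : ∀ i ∈ S, b.IsPos i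
  convex : IsConvexSet P S
  coconvex : IsCoconvexSet b S

lemma isBiconvexSet_isPos (b : P.Base) : IsBiconvexSet b {i | b.IsPos i} :=
  ⟨fun _ h => h, isConvexSet_isPos b, fun _ _ _ _ hi _ _ => Or.inl hi⟩

lemma IsBiconvexSet.compl {b : P.Base} {S : Set ι} (hS : IsBiconvexSet b S) :
    IsBiconvexSet b ({i | b.IsPos i} \ S) where
  isPos i hi := hi.1
  convex i hi j hj k h := ⟨hi.1.add hj.1 h, fun hk =>
    (hS.coconvex k hk i j hi.1 hj.1 h).elim hi.2 hj.2⟩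
  coconvex k hk i j hi hj h := by
    by_contra! hcon
    have hi' : i ∈ S := by by_contra h'; exact hcon.1 ⟨hi, h'⟩
    have hj' : j ∈ S := by by_contra h'; exact hcon.2 ⟨hj, h'⟩
    exact hk.2 (hS.convex i hi' j hj' k h)

lemma IsCoconvexSet.union {b : P.Base} {S T : Set ι} (hS : IsCoconvexSet b S)
    (hT : IsCoconvexSet b T) : IsCoconvexSet b (S ∪ T) := by
  rintro k (hk | hk) i j hi hj h
  · exact (hS k hk i j hi hj h).imp Or.inl Or.inl
  · exact (hT k hk i j hi hj h).imp Or.inr Or.inr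

section Finite

variable [Finite ι] [P.IsCrystallographic]

/-- Let `s + t = x + y` with `s`, `t` in the closure. Some pairing between the two decompositions is
positive, say that of `x` with `s`, so `z = x - s` is a root unless `x = s`. If `z` is positive,
induction applies to `t = y + z`, and `x = s + z`; otherwise it applies to `s = x + (-z)`, and `y =
t + (-z)`. -/
lemma IsCoconvexSet.sumClosure {b : P.Base} {S : Set ι} (hS : IsCoconvexSet b S)
    (hpos : ∀ i ∈ S, b.IsPos i) : IsCoconvexSet b (sumClosure P S) := by
  have hpos' : ∀ i ∈ TwistedWeyl.sumClosure P S, b.IsPos i :=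
    sumClosure_subset (isConvexSet_isPos b) hpos
  intro k hk
  induction hk with
  | base h => exact fun i j hi hj e => (hS _ h i j hi hj e).imp .base .base
  | @add s t k hs ht e ihs iht =>
    have key {s t x y : ι} (hs : s ∈ TwistedWeyl.sumClosure P S)
        (ht : t ∈ TwistedWeyl.sumClosure P S)
        (ihs : ∀ i j, b.IsPos i → b.IsPos j → P.root s = P.root i + P.root j →
          i ∈ TwistedWeyl.sumClosure P S ∨ j ∈ TwistedWeyl.sumClosure P S)
        (iht : ∀ i j, b.IsPos i → b.IsPos j → P.root t = P.root i + P.root j →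
          i ∈ TwistedWeyl.sumClosure P S ∨ j ∈ TwistedWeyl.sumClosure P S)
        (hx : b.IsPos x) (hy : b.IsPos y) (e : P.root s + P.root t = P.root x + P.root y)
        (hxs : 0 < P.pairingIn ℤ x s) :
        x ∈ TwistedWeyl.sumClosure P S ∨ y ∈ TwistedWeyl.sumClosure P S := by
      rcases eq_or_ne x s with rfl | hne
      · exact Or.inl hs
      obtain ⟨z, hz⟩ := exists_root_eq_sub hxs hne
      by_cases hzp : b.IsPos z
      · have hxz : P.root x = P.root s + P.root z := by rw [hz]; abel
        rcases iht y z hy hzp (by rw [hz, ← sub_eq_zero]; rw [← sub_eq_zero] at e; rw [← e]; abel)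
          with h | h
        · exact Or.inr h
        · exact Or.inl (.add hs h hxz)
      · rw [← isPos_negIdx] at hzp
        rcases ihs x (negIdx P z) hx hzp (by rw [root_negIdx, hz]; abel) with h | h
        · exact Or.inl h
        · refine Or.inr (.add ht h ?_)
          rw [root_negIdx, hz, ← sub_eq_zero]
          rw [← sub_eq_zero] at e
          rw [← neg_eq_zero, ← e]; abel
    intro x y hx hy e'
    have e'' : P.root s + P.root t = P.root x + P.root y := e.symm.trans e'
    rcases exists_pairingIn_pos_of_add_eq_add e' e with (h | h) | (h | h)
    · exact key hs ht ihs iht hx hy e'' h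
    · exact key ht hs iht ihs hx hy (by rw [add_comm, e'']) h
    · exact (key hs ht ihs iht hy hx (by rw [e'', add_comm]) h).symm
    · exact (key ht hs iht ihs hy hx (by rw [add_comm, e'', add_comm]) h).symm

lemma IsBiconvexSet.sumClosure_union {b : P.Base} {S T : Set ι} (hS : IsBiconvexSet b S)
    (hT : IsBiconvexSet b T) : IsBiconvexSet b (sumClosure P (S ∪ T)) := by
  have h : ∀ i ∈ S ∪ T, b.IsPos i := fun i hi => hi.elim (hS.isPos i) (hT.isPos i)
  exact ⟨sumClosure_subset (isConvexSet_isPos b) h, isConvexSet_sumClosure _,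
    (hS.coconvex.union hT.coconvex).sumClosure h⟩

end Finite

/-! ### Inversion sets -/

lemma isBiconvexSet_inversionSet (b : P.Base) (w : P.Aut) : IsBiconvexSet b (inversionSet b w) where
  isPos i hi := hi.1
  convex := (isConvexSet_isPos b).inter (isConvexSet_preimage_smul w (isConvexSet_not_isPos b))
  coconvex k hk i j hi hj h := by
    by_contra! hcon
    simp only [inversionSet, Set.mem_ofPred_eq, hi, hj, true_and, not_not] at hcon
    exact hk.2 (hcon.1.add hcon.2 (root_smul_eq_add w h))

lemma negIdx_smul_mem_inversionSet_inv {b : P.Base} {w : P.Aut} {i : ι}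
    (hi : i ∈ inversionSet b w) : negIdx P (w • i) ∈ inversionSet b w⁻¹ := by
  simpa [inversionSet] using hi.symm

lemma mem_inversionSet_mul_of_isPos {b : P.Base} {x y : P.Aut} {i : ι} (hi : b.IsPos i)
    (hy : b.IsPos (y • i)) : i ∈ inversionSet b (x * y) ↔ y • i ∈ inversionSet b x := by
  simp [-RootPairing.Equiv.mul_eq_comp, inversionSet, hi, hy, mul_smul]

lemma mem_inversionSet_mul_of_mem {b : P.Base} {x y : P.Aut} {i : ι}
    (hi : i ∈ inversionSet b y) :
    i ∈ inversionSet b (x * y) ↔ negIdx P (y • i) ∉ inversionSet b x := by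
  simp [-RootPairing.Equiv.mul_eq_comp, inversionSet, hi.1, hi.2, mul_smul]

open Classical in
/-- The positive one of the roots `w β` and `-w β`. -/
noncomputable def posSmul (b : P.Base) (w : P.Aut) (i : ι) : ι :=
  if b.IsPos (w • i) then w • i else negIdx P (w • i)

lemma posSmul_inv_posSmul (b : P.Base) (w : P.Aut) {i : ι} (hi : b.IsPos i) :
    posSmul b w⁻¹ (posSmul b w i) = i := by
  by_cases h : b.IsPos (w • i) <;> simp [posSmul, h, hi]

lemma isPos_posSmul (b : P.Base) (w : P.Aut) (i : ι) : b.IsPos (posSmul b w i) := by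
  by_cases h : b.IsPos (w • i) <;> simp [posSmul, h]

lemma mem_inversionSet_inv_posSmul {b : P.Base} {w : P.Aut} {i : ι} (hi : b.IsPos i) :
    posSmul b w i ∈ inversionSet b w⁻¹ ↔ i ∈ inversionSet b w := by
  by_cases h : b.IsPos (w • i) <;> simp [posSmul, h, hi, inversionSet]

/-- The cocycle rule for inversion sets. It turns additivity of lengths into disjointness without
reduced words, and so covers twisted elements too. -/
lemma mem_inversionSet_mul_iff {b : P.Base} {x y : P.Aut} {i : ι} (hi : b.IsPos i) :
    i ∈ inversionSet b (x * y) ↔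
      posSmul b y i ∈ symmDiff (inversionSet b x) (inversionSet b y⁻¹) := by
  rw [Set.mem_symmDiff, mem_inversionSet_inv_posSmul hi]
  by_cases h : b.IsPos (y • i)
  · have : i ∉ inversionSet b y := fun h' => h'.2 h
    simp [-RootPairing.Equiv.mul_eq_comp, mem_inversionSet_mul_of_isPos hi h,
       this, posSmul, h]
  · have : i ∈ inversionSet b y := ⟨hi, h⟩
    simp [-RootPairing.Equiv.mul_eq_comp, mem_inversionSet_mul_of_mem this, this, posSmul, h]

lemma ncard_posSmul_preimage (b : P.Base) (w : P.Aut) {S : Set ι} (hS : ∀ i ∈ S, b.IsPos i) :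
    {i | b.IsPos i ∧ posSmul b w i ∈ S}.ncard = S.ncard := by
  refine Set.ncard_congr (fun i _ => posSmul b w i) (fun i hi => hi.2) ?_ ?_
  · intro i j hi hj h
    rw [← posSmul_inv_posSmul b w hi.1, h, posSmul_inv_posSmul b w hj.1]
  · intro j hj
    have := posSmul_inv_posSmul b w⁻¹ (hS j hj)
    rw [inv_inv] at this
    exact ⟨posSmul b w⁻¹ j, ⟨isPos_posSmul _ _ _, by rwa [this]⟩, this⟩

lemma length_inv (b : P.Base) (w : P.Aut) : length b w⁻¹ = length b w := by
  rw [length, ← ncard_posSmul_preimage b w (isBiconvexSet_inversionSet b w⁻¹).isPos, length]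
  congr 1
  ext i
  by_cases hi : b.IsPos i
  · simp [-RootPairing.Equiv.mul_eq_comp, hi, mem_inversionSet_inv_posSmul]
  · simp [hi, inversionSet]

section Finite

variable [Finite ι]

lemma length_mul_add (b : P.Base) (x y : P.Aut) :
    length b (x * y) + 2 * (inversionSet b x ∩ inversionSet b y⁻¹).ncard =
      length b x + length b y := by
  have h : length b (x * y) = (symmDiff (inversionSet b x) (inversionSet b y⁻¹)).ncard := by
    rw [← ncard_posSmul_preimage b y, length]
    · congr 1
      ext i
      by_cases hi : b.IsPos i
      · simp [-RootPairing.Equiv.mul_eq_comp, hi, mem_inversionSet_mul_iff hi]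
      · simp [hi, inversionSet]
    · rintro i (hi | hi) <;> exact hi.1.1
  rw [h, ← length_inv b y, length, length, Set.symmDiff_def, Set.ncard_union_eq
    (Set.disjoint_left.mpr fun i hi hi' => hi.2 hi'.1)]
  have h1 := Set.ncard_inter_add_ncard_sdiff_eq_ncard (inversionSet b x) (inversionSet b y⁻¹)
  have h2 := Set.ncard_inter_add_ncard_sdiff_eq_ncard (inversionSet b y⁻¹) (inversionSet b x)
  rw [Set.inter_comm] at h2
  lia

lemma length_mul_iff {b : P.Base} {x y : P.Aut} :
    length b (x * y) = length b x + length b y ↔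
      Disjoint (inversionSet b x) (inversionSet b y⁻¹) := by
  rw [Set.disjoint_iff_inter_eq_empty, ← Set.ncard_eq_zero]
  have := length_mul_add b x y
  lia

lemma length_mul_inv_add {b : P.Base} {x u : P.Aut} (h : inversionSet b u ⊆ inversionSet b x) :
    length b x = length b (x * u⁻¹) + length b u := by
  have : Disjoint (inversionSet b (x * u⁻¹)) (inversionSet b u⁻¹) := by
    refine Set.disjoint_left.mpr fun i hi hi' => ?_
    rw [mem_inversionSet_mul_of_mem hi'] at hi
    apply hi (h _)
    simpa using negIdx_smul_mem_inversionSet_inv hi'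
  rw [← length_mul_iff.mpr this, inv_mul_cancel_right]

/-! ### The action of automorphisms on biconvex sets -/

variable [P.IsCrystallographic]

/-- If `K` is the complement of the inversion set of `u` in the positive roots, then
`transport b y K` is the complement of the inversion set of the right Deligne-Garside factor
of `b_u b_y`. -/
def transport (b : P.Base) (y : P.Aut) (S : Set ι) : Set ι :=
  {i | b.IsPos i ∧ y • i ∈ sumClosure P (S ∪ inversionSet b y⁻¹)}

lemma IsBiconvexSet.transport {b : P.Base} {S : Set ι} (hS : IsBiconvexSet b S) (y : P.Aut) :
    IsBiconvexSet b (transport b y S) := by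
  have hC := hS.sumClosure_union (isBiconvexSet_inversionSet b y⁻¹)
  refine ⟨fun i hi => hi.1,
    (isConvexSet_isPos b).inter (isConvexSet_preimage_smul y hC.convex), ?_⟩
  -- If `y` inverts a summand `i` of `k`, then `-y i` is an inversion of `y⁻¹`, and adding it to `y
  -- k` gives `y j`.
  have key {i j k : ι} (hi : b.IsPos i) (hyi : ¬ b.IsPos (y • i))
      (hk : k ∈ TwistedWeyl.transport b y S) (h : P.root k = P.root i + P.root j) :
      y • j ∈ sumClosure P (S ∪ inversionSet b y⁻¹) := by
    refine .add hk.2 (.base (Or.inr (negIdx_smul_mem_inversionSet_inv ⟨hi, hyi⟩))) ?_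
    rw [root_smul_eq_add y h, root_negIdx]; abel
  intro k hk i j hi hj h
  by_cases hyi : b.IsPos (y • i)
  · by_cases hyj : b.IsPos (y • j)
    · exact (hC.coconvex _ hk.2 _ _ hyi hyj (root_smul_eq_add y h)).imp (⟨hi, ·⟩) (⟨hj, ·⟩)
    · exact Or.inl ⟨hi, key hj hyj hk (by rw [h, add_comm])⟩
  · exact Or.inr ⟨hj, key hi hyi hk h⟩

lemma transport_one {b : P.Base} {S : Set ι} (hS : IsBiconvexSet b S) :
    transport b 1 S = S := by
  have h : inversionSet b (1 : P.Aut)⁻¹ = ∅ := by ext i; simp [inversionSet]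
  ext i
  rw [transport, h, Set.union_empty, Set.mem_ofPred_eq, one_smul]
  exact ⟨fun hi => sumClosure_subset hS.convex subset_rfl hi.2,
    fun hi => ⟨hS.isPos i hi, .base hi⟩⟩

/-- With `D` the closure of `S` and the inversions of `(xy)⁻¹`, the point is `x E ⊆ D ⊆ x E ∪
inversionSet b x⁻¹`. The extra inversions are harmless: if `xy i` is one for positive `i`, then `-y
i` is an inversion of both `x` and `y⁻¹`, against disjointness. -/
lemma transport_mul {b : P.Base} {x y : P.Aut}
    (h : Disjoint (inversionSet b x) (inversionSet b y⁻¹)) {S : Set ι} (hS : IsBiconvexSet b S) :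
    transport b (x * y) S = transport b y (transport b x S) := by
  have hE := (hS.transport x).sumClosure_union (isBiconvexSet_inversionSet b y⁻¹)
  set E := sumClosure P (transport b x S ∪ inversionSet b y⁻¹) with hEdef
  have hxE : ∀ i ∈ E, b.IsPos (x • i) := by
    have hpos : ∀ i ∈ S ∪ inversionSet b x⁻¹, b.IsPos i :=
      fun i hi => hi.elim (hS.isPos i) (·.1)
    refine sumClosure_subset (isConvexSet_preimage_smul x (isConvexSet_isPos b)) ?_
    rintro i (hi | hi)
    · exact sumClosure_subset (isConvexSet_isPos b) hpos hi.2
    · by_contra hx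
      exact Set.disjoint_left.mp h ⟨hi.1, hx⟩ hi
  have hsub : inversionSet b x⁻¹ ⊆ inversionSet b (x * y)⁻¹ := by
    intro i hi
    have := negIdx_smul_mem_inversionSet_inv hi
    rw [inv_inv] at this
    rw [mul_inv_rev, mem_inversionSet_mul_of_mem hi]
    exact Set.disjoint_left.mp h this
  have hED : E ⊆ {i | x • i ∈ sumClosure P (S ∪ inversionSet b (x * y)⁻¹)} := by
    refine sumClosure_subset (isConvexSet_preimage_smul x (isConvexSet_sumClosure _)) ?_
    rintro i (hi | hi)
    · exact sumClosure_mono (Set.union_subset_union_right _ hsub) hi.2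
    · refine .base (Or.inr ⟨?_, ?_⟩)
      · by_contra hx
        exact Set.disjoint_left.mp h ⟨hi.1, hx⟩ hi
      · simpa [-RootPairing.Equiv.mul_eq_comp, mul_inv_rev, mul_smul] using hi.2
  -- In the mixed case with `x⁻¹ k` positive, `x⁻¹ i ∈ E` is the sum of the positive roots `x⁻¹ k`
  -- and `-x⁻¹ j`. Coconvexity puts one of them in `E`; it is not the second, since `x` maps `E` to
  -- positive roots.
  have hF : IsConvexSet P {i | x⁻¹ • i ∈ E ∨ i ∈ inversionSet b x⁻¹} := by
    have key {i j k : ι} (hi : x⁻¹ • i ∈ E) (hj : j ∈ inversionSet b x⁻¹)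
        (e : P.root k = P.root i + P.root j) : x⁻¹ • k ∈ E ∨ k ∈ inversionSet b x⁻¹ := by
      have hip : b.IsPos i := by simpa using hxE _ hi
      by_cases hk : b.IsPos (x⁻¹ • k)
      · refine Or.inl ?_
        have hj' : b.IsPos (negIdx P (x⁻¹ • j)) := by simpa using hj.2
        refine (hE.coconvex _ hi _ _ hk hj' ?_).resolve_right fun hjE => ?_
        · rw [root_negIdx, root_smul_eq_add _ e]; abel
        · have := hxE _ hjE
          simp [hj.1] at this
      · exact Or.inr ⟨hip.add hj.1 e, hk⟩
    rintro i (hi | hi) j (hj | hj) k e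
    · exact Or.inl (hE.convex _ hi _ hj _ (root_smul_eq_add _ e))
    · exact key hi hj e
    · exact key hj hi (by rw [e, add_comm])
    · exact Or.inr ((isBiconvexSet_inversionSet b x⁻¹).convex _ hi _ hj _ e)
  have hDF : sumClosure P (S ∪ inversionSet b (x * y)⁻¹) ⊆
      {i | x⁻¹ • i ∈ E ∨ i ∈ inversionSet b x⁻¹} := by
    refine sumClosure_subset hF ?_
    intro i hi
    have hip : b.IsPos i := hi.elim (hS.isPos i) (·.1)
    by_cases hx : b.IsPos (x⁻¹ • i)
    · refine Or.inl (.base ?_)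
      rcases hi with hi | hi
      · exact Or.inl ⟨hx, by rw [smul_inv_smul]; exact .base (Or.inl hi)⟩
      · refine Or.inr ⟨hx, ?_⟩
        simpa [-RootPairing.Equiv.mul_eq_comp, mul_smul] using hi.2
    · exact Or.inr ⟨hip, hx⟩
  ext i
  refine and_congr_right fun hi => ⟨fun hxy => ?_, fun hy => ?_⟩
  · rcases hDF hxy with h' | h'
    · rwa [mul_smul, inv_smul_smul] at h'
    · have h1 : i ∈ inversionSet b y := ⟨hi, by simpa [-RootPairing.Equiv.mul_eq_comp, mul_smul]
        using h'.2⟩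
      have h2 : negIdx P (y • i) ∈ inversionSet b x := by
        refine ⟨by simpa using h1.2, ?_⟩
        simpa [-RootPairing.Equiv.mul_eq_comp, mul_smul] using h'.1
      exact (Set.disjoint_left.mp h h2 (negIdx_smul_mem_inversionSet_inv h1)).elim
  · rw [mul_smul]
    exact hED hy

end Finite

/-! ### The Weyl group and inversion sets -/

lemma reflection_smul_eq (i j : ι) :
    RootPairing.Equiv.reflection P i • j = P.reflectionPerm i j := rfl

lemma toLinearMap_smul_coroot (g : P.Aut) (x : M) (i : ι) :
    P.toLinearMap (g • x) (P.coroot (g • i)) = P.toLinearMap x (P.coroot i) := by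
  have h1 : g.coweightMap (P.coroot (g • i)) = P.coroot i := by
    rw [RootPairing.Hom.coroot_coweightMap_apply]
    exact congrArg P.coroot (g.indexEquiv.symm_apply_apply i)
  rw [← h1]
  exact DFunLike.congr_fun
    (RootPairing.Hom.weight_coweight_transpose_apply P P (P.coroot (g • i)) g.toHom) x

lemma conj_reflection (g : P.Aut) (i : ι) :
    g * RootPairing.Equiv.reflection P i * g⁻¹ = RootPairing.Equiv.reflection P (g • i) := by
  apply RootPairing.Equiv.weightHom_injective P
  ext x
  change (g * RootPairing.Equiv.reflection P i * g⁻¹) • x =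
    RootPairing.Equiv.reflection P (g • i) • x
  rw [mul_smul, mul_smul, RootPairing.Equiv.reflection_smul, RootPairing.Equiv.reflection_smul,
    RootPairing.reflection_apply, RootPairing.reflection_apply, smul_sub, smul_inv_smul,
    smul_comm g, root_smul]
  congr 2
  have := toLinearMap_smul_coroot g (g⁻¹ • x) i
  rw [smul_inv_smul] at this
  exact this.symm

section Finite

variable [Finite ι] [P.IsCrystallographic] [P.IsReduced]

lemma isPos_reflection_smul {b : P.Base} {i j : ι} (hi : i ∈ b.support) (hj : b.IsPos j)
    (hij : j ≠ i) : b.IsPos (RootPairing.Equiv.reflection P i • j) :=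
  hj.reflectionPerm hi hij

lemma reflection_smul_self (i : ι) : RootPairing.Equiv.reflection P i • i = negIdx P i := rfl

/-- The product of the reflections in the roots of a list. -/
noncomputable def reflectionProd (P : RootPairing ι K M N) (l : List ι) : P.Aut :=
  (l.map (RootPairing.Equiv.reflection P)).prod

lemma exists_reflectionProd_eq (b : P.Base) {u : P.Aut} (hu : u ∈ P.weylGroup) :
    ∃ l : List ι, (∀ i ∈ l, i ∈ b.support) ∧ reflectionProd P l = u := by
  let H : Subgroup P.Aut :=
    Subgroup.closure (RootPairing.Equiv.reflection P '' {i | i ∈ b.support})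
  have hs : ∀ i ∈ b.support, RootPairing.Equiv.reflection P i ∈ H :=
    fun i hi => Subgroup.subset_closure ⟨i, hi, rfl⟩
  have hpos : ∀ i, b.IsPos i → RootPairing.Equiv.reflection P i ∈ H := by
    intro i hi
    refine hi.induction_on_reflect hs fun i j hi hj => ?_
    rw [← reflection_smul_eq, ← conj_reflection]
    exact mul_mem (mul_mem (hs j hj) hi) (inv_mem (hs j hj))
  have hle : P.weylGroup ≤ H := by
    rw [RootPairing.weylGroup, Subgroup.closure_le]
    rintro _ ⟨i, rfl⟩
    by_cases hi : b.IsPos i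
    · exact hpos i hi
    · have h := hpos (negIdx P i) (by simpa using hi)
      rw [← reflection_smul_self, ← conj_reflection, mul_inv_cancel_right] at h
      exact h
  have hu' : u ∈ H.toSubmonoid := hle hu
  rw [Subgroup.closure_toSubmonoid, show (RootPairing.Equiv.reflection P '' {i | i ∈ b.support})⁻¹ =
    RootPairing.Equiv.reflection P '' {i | i ∈ b.support} by
      ext g; simp [eq_comm, ← Set.image_inv_eq_inv], Set.union_self] at hu'
  clear hu
  induction hu' using Submonoid.closure_induction with
  | mem x hx =>
    obtain ⟨i, hi, rfl⟩ := hx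
    exact ⟨[i], by simpa using hi, by simp [reflectionProd]⟩
  | one => exact ⟨[], by simp, rfl⟩
  | mul x y _ _ hx hy =>
    obtain ⟨l, hl, rfl⟩ := hx
    obtain ⟨l', hl', rfl⟩ := hy
    exact ⟨l ++ l', by simpa [or_imp, forall_and] using ⟨hl, hl'⟩, by simp [reflectionProd]⟩

/-- The exchange condition. -/
lemma exists_reflectionProd_eq_mul {b : P.Base} {i : ι} (hi : i ∈ b.support) (l : List ι)
    (hl : ∀ j ∈ l, j ∈ b.support) (h : ¬ b.IsPos (reflectionProd P l • i)) :
    ∃ l' : List ι, (∀ j ∈ l', j ∈ b.support) ∧ l'.length + 1 = l.length ∧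
      reflectionProd P l' = reflectionProd P l * RootPairing.Equiv.reflection P i := by
  induction l with
  | nil => exact (h (RootPairing.Base.isPos_of_mem_support hi)).elim
  | cons j l ih =>
    have hcons (l : List ι) : reflectionProd P (j :: l) =
      RootPairing.Equiv.reflection P j * reflectionProd P l := by simp [reflectionProd]
    simp only [List.mem_cons, forall_eq_or_imp] at hl
    rw [hcons, mul_smul] at h
    by_cases hv : b.IsPos (reflectionProd P l • i)
    · have hij : reflectionProd P l • i = j := by
        by_contra hne
        exact h (isPos_reflection_smul hl.1 hv hne)
      refine ⟨l, hl.2, by simp, ?_⟩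
      rw [hcons, ← hij, ← conj_reflection, inv_mul_cancel_right, mul_assoc,
        mul_eq_one_iff_inv_eq.mpr (RootPairing.Equiv.reflection_inv P i), mul_one]
    · obtain ⟨l', h1, h2, h3⟩ := ih hl.2 hv
      refine ⟨j :: l', by simpa using ⟨hl.1, h1⟩, by simp [h2], ?_⟩
      rw [hcons, hcons, h3, mul_assoc]

/-- The last letter of a nonempty word is not inverted by the product, so the word without it makes
that simple root negative. Exchange then yields a word for the same element that is two letters
shorter. -/
lemma eq_one_of_inversionSet_eq_empty {b : P.Base} {u : P.Aut} (hu : u ∈ P.weylGroup)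
    (h : inversionSet b u = ∅) : u = 1 := by
  obtain ⟨l, hl, rfl⟩ := exists_reflectionProd_eq b hu
  clear hu
  induction hn : l.length using Nat.strong_induction_on generalizing l with
  | _ n ih =>
    rcases List.eq_nil_or_concat' l with rfl | ⟨l, i, rfl⟩
    · rfl
    simp only [List.mem_append, List.mem_singleton] at hl
    have hi := hl i (Or.inr rfl)
    have hconcat : reflectionProd P (l ++ [i]) =
      reflectionProd P l * RootPairing.Equiv.reflection P i := by simp [reflectionProd]
    have hneg : ¬ b.IsPos (reflectionProd P l • i) := by
      intro hp
      have hip := RootPairing.Base.isPos_of_mem_support hi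
      refine Set.eq_empty_iff_forall_notMem.mp h i ⟨hip, ?_⟩
      rw [hconcat, mul_smul, reflection_smul_self]
      simpa using hp
    obtain ⟨l', h1, h2, h3⟩ := exists_reflectionProd_eq_mul hi l (fun j hj => hl j (Or.inl hj)) hneg
    rw [hconcat, ← h3] at h ⊢
    refine ih l'.length ?_ l' h1 h rfl
    rw [← hn, List.length_append]
    lia

lemma inversionSet_mul_inv_eq_empty {b : P.Base} {u v : P.Aut}
    (h : inversionSet b u = inversionSet b v) : inversionSet b (u * v⁻¹) = ∅ := by
  have h1 := length_mul_inv_add h.ge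
  rw [length, length, length, h] at h1
  rw [← Set.ncard_eq_zero]
  lia

lemma eq_of_inversionSet_eq {b : P.Base} {u v : P.Aut} (hu : u ∈ P.weylGroup)
    (hv : v ∈ P.weylGroup) (h : inversionSet b u = inversionSet b v) : u = v :=
  mul_inv_eq_one.mp (eq_one_of_inversionSet_eq_empty (mul_mem hu (inv_mem hv))
    (inversionSet_mul_inv_eq_empty h))

lemma IsBiconvexSet.exists_mem_support {b : P.Base} {S : Set ι} (hS : IsBiconvexSet b S)
    (hne : S.Nonempty) : ∃ i ∈ S, i ∈ b.support := by
  by_contra! hcon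
  obtain ⟨i, hi⟩ := hne
  have key : b.IsPos i ∧ i ∉ S := (hS.isPos i hi).induction_on_add (p := fun i => b.IsPos i ∧ i ∉ S)
    (fun i hi => ⟨RootPairing.Base.isPos_of_mem_support hi, fun h => hcon i h hi⟩)
    (fun i j k h hi hj => by
      have hjp := RootPairing.Base.isPos_of_mem_support hj
      exact ⟨hi.1.add hjp h, fun hk => (hS.coconvex k hk i j hi.1 hjp h).elim hi.2
        fun hjS => hcon j hjS hj⟩)
  exact key.2 hi

/-- A biconvex set of positive roots is the inversion set of an element of the Weyl group. -/
lemma IsBiconvexSet.exists_inversionSet_eq {b : P.Base} {S : Set ι} (hS : IsBiconvexSet b S) :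
    ∃ u ∈ P.weylGroup, inversionSet b u = S := by
  induction hn : S.ncard using Nat.strong_induction_on generalizing S with
  | _ n ih =>
    rcases S.eq_empty_or_nonempty with rfl | hne
    · exact ⟨1, one_mem _, by ext i; simp [inversionSet]⟩
    obtain ⟨α, hαS, hα⟩ := hS.exists_mem_support hne
    set s := RootPairing.Equiv.reflection P α with hs
    have hαpos := RootPairing.Base.isPos_of_mem_support hα
    have hss (i : ι) : s • s • i = i := by
      rw [← mul_smul, mul_eq_one_iff_inv_eq.mpr (RootPairing.Equiv.reflection_inv P α), one_smul]
    have hsα : s • α = negIdx P α := reflection_smul_self α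
    have hspos {i : ι} (hi : b.IsPos i) (hne : i ≠ α) : b.IsPos (s • i) :=
      isPos_reflection_smul hα hi hne
    have hne' {i : ι} (hi : b.IsPos i) : s • i ≠ α := by
      intro h
      have h' : i = negIdx P α := by rw [← hss i, h, hsα]
      rw [h'] at hi
      simp [hαpos] at hi
    -- Peeling off the simple root `α` leaves `s (S \ {α})`, which should be the inversion set of
    -- `u` when `S` is that of `u * s`.
    have hT : IsBiconvexSet b {i | b.IsPos i ∧ s • i ∈ S} := by
      refine ⟨fun i hi => hi.1,
        (isConvexSet_isPos b).inter (isConvexSet_preimage_smul s hS.convex), ?_⟩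
      have key {i j k : ι} (hk : s • k ∈ S) (hj : b.IsPos j)
          (h : P.root k = P.root α + P.root j) : s • j ∈ S := by
        refine hS.convex _ hk _ hαS _ ?_
        have := root_smul_eq_add s h
        rw [hsα, root_negIdx] at this
        rw [this]; abel
      intro k hk i j hi hj h
      rcases eq_or_ne i α with rfl | hiα
      · exact Or.inr ⟨hj, key (i := i) hk.2 hj h⟩
      rcases eq_or_ne j α with rfl | hjα
      · exact Or.inl ⟨hi, key (i := i) hk.2 hi (by rw [h, add_comm])⟩
      · exact (hS.coconvex _ hk.2 _ _ (hspos hi hiα) (hspos hj hjα) (root_smul_eq_add s h)).imp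
          (⟨hi, ·⟩) (⟨hj, ·⟩)
    have hcard : {i | b.IsPos i ∧ s • i ∈ S}.ncard < n := by
      rw [← hn]
      refine lt_of_le_of_lt (Set.ncard_le_ncard_of_injOn (s • ·) ?_
        (MulAction.injective s).injOn (t := S \ {α})) (Set.ncard_sdiff_singleton_lt_of_mem hαS)
      exact fun i hi => ⟨hi.2, hne' hi.1⟩
    obtain ⟨u, hu, huT⟩ := ih _ hcard hT rfl
    refine ⟨u * s, mul_mem hu (P.reflection_mem_weylGroup α), ?_⟩
    have hαu : b.IsPos (u • α) := by
      by_contra h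
      have : α ∈ inversionSet b u := ⟨hαpos, h⟩
      rw [huT] at this
      have := hS.isPos _ this.2
      rw [hsα] at this
      simp [hαpos] at this
    ext i
    by_cases hi : b.IsPos i
    · rcases eq_or_ne i α with rfl | hiα
      · simp [-RootPairing.Equiv.mul_eq_comp, inversionSet, mul_smul, hsα, hαu, hi, hαS]
      · rw [mem_inversionSet_mul_of_isPos hi (hspos hi hiα), huT]
        simp [hss, hspos hi hiα]
    · exact iff_of_false (fun h => hi h.1) fun h => hi (hS.isPos i h)

end Finite

/-! ### Stable roots -/

lemma isBiconvexSet_unstablePositiveRoots {b : P.Base} {w : P.Aut} (hw : IsConvexElement b w) :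
    IsBiconvexSet b (unstablePositiveRoots b w) where
  isPos i hi := hi.1
  convex := hw
  coconvex k hk i j hi hj h := by
    by_contra! hcon
    have key (i : ι) (hi : b.IsPos i) (hi' : i ∉ unstablePositiveRoots b w) :
        ∀ n : ℤ, b.IsPos (w ^ n • i) := by
      have : i ∈ stableRoots b w := by by_contra h'; exact hi' ⟨hi, h'⟩
      exact this.resolve_right fun h' => h' 0 (by simpa using hi)
    exact hk.2 (Or.inl fun n => (key i hi hcon.1 n).add (key j hj hcon.2 n) (root_smul_eq_add _ h))

lemma stableRoots_inv (b : P.Base) (w : P.Aut) : stableRoots b w⁻¹ = stableRoots b w := by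
  ext i
  simp only [stableRoots, Set.mem_ofPred_eq, inv_zpow']
  exact or_congr ⟨fun h n => by simpa using h (-n), fun h n => h (-n)⟩
    ⟨fun h n => by simpa using h (-n), fun h n => h (-n)⟩

lemma unstablePositiveRoots_inv (b : P.Base) (w : P.Aut) :
    unstablePositiveRoots b w⁻¹ = unstablePositiveRoots b w := by
  rw [unstablePositiveRoots, stableRoots_inv, unstablePositiveRoots]

lemma smul_mem_stableRoots_iff (b : P.Base) (w : P.Aut) (i : ι) :
    w • i ∈ stableRoots b w ↔ i ∈ stableRoots b w := by
  simp only [stableRoots, Set.mem_ofPred_eq, ← mul_smul, ← zpow_add_one]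
  exact or_congr ⟨fun h n => by simpa using h (n - 1), fun h n => h (n + 1)⟩
    ⟨fun h n => by simpa using h (n - 1), fun h n => h (n + 1)⟩

lemma inversionSet_subset_unstablePositiveRoots (b : P.Base) (w : P.Aut) :
    inversionSet b w ⊆ unstablePositiveRoots b w := by
  refine fun i hi => ⟨hi.1, ?_⟩
  rintro (h | h)
  · exact hi.2 (by simpa using h 1)
  · exact h 0 (by simpa using hi.1)

lemma smul_mem_diff_unstablePositiveRoots {b : P.Base} {w : P.Aut} {i : ι}
    (hi : i ∈ {i | b.IsPos i} \ unstablePositiveRoots b w) :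
    w • i ∈ {i | b.IsPos i} \ unstablePositiveRoots b w := by
  have hs : i ∈ stableRoots b w := by by_contra h; exact hi.2 ⟨hi.1, h⟩
  refine ⟨?_, fun h => h.2 ((smul_mem_stableRoots_iff b w i).mpr hs)⟩
  rcases hs with h | h
  · simpa using h 1
  · exact (h 0 (by simpa using hi.1)).elim

/-! ### Deligne-Garside factors -/

section Braid

variable [Finite ι] [P.IsCrystallographic]

/-- The map `transport` on biconvex sets, in the opposite of the monoid of their self-maps. -/
def transportEnd (b : P.Base) (w : P.Aut) :
    (Function.End {S : Set ι // IsBiconvexSet b S})ᵐᵒᵖ :=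
  MulOpposite.op fun S => ⟨transport b w S, S.2.transport w⟩

/-- The right action of the twisted braid monoid on biconvex sets of positive roots. -/
noncomputable def braidAction (b : P.Base) (Ω : Subgroup P.Aut) :
    BraidMonoid b Ω →* (Function.End {S : Set ι // IsBiconvexSet b S})ᵐᵒᵖ :=
  PresentedMonoid.lift (rels := BraidRel b Ω)
    (fun w : twistedWeylGroup P Ω => transportEnd b (w : P.Aut)) <| by
    rintro _ _ (_ | ⟨x, y, h⟩)
    · rw [FreeMonoid.lift_eval_of, map_one]
      exact MulOpposite.unop_injective (funext fun S => Subtype.ext (transport_one S.2))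
    · rw [map_mul, FreeMonoid.lift_eval_of, FreeMonoid.lift_eval_of, FreeMonoid.lift_eval_of]
      exact MulOpposite.unop_injective (funext fun S =>
        Subtype.ext (transport_mul (length_mul_iff.mp h) S.2).symm)

lemma braidAction_reducedBraid (b : P.Base) (Ω : Subgroup P.Aut) (w : twistedWeylGroup P Ω) :
    braidAction b Ω (reducedBraid b Ω w) = transportEnd b (w : P.Aut) :=
  rfl

/-- The positive roots which are not inversions of the right Deligne-Garside factor of a braid. -/
noncomputable def nonInversions (b : P.Base) (Ω : Subgroup P.Aut) (β : BraidMonoid b Ω) : Set ι :=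
  ((braidAction b Ω β).unop ⟨_, isBiconvexSet_isPos b⟩ : {S : Set ι // IsBiconvexSet b S})

variable {b : P.Base} {Ω : Subgroup P.Aut}

lemma isBiconvexSet_nonInversions (β : BraidMonoid b Ω) :
    IsBiconvexSet b (nonInversions b Ω β) :=
  Subtype.prop _

lemma nonInversions_one : nonInversions b Ω 1 = {i | b.IsPos i} := by
  rw [nonInversions, map_one]; rfl

lemma nonInversions_mul_reducedBraid (β : BraidMonoid b Ω) (w : twistedWeylGroup P Ω) :
    nonInversions b Ω (β * reducedBraid b Ω w) = transport b w (nonInversions b Ω β) := by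
  rw [nonInversions, map_mul, braidAction_reducedBraid]; rfl

lemma nonInversions_reducedBraid_pow (w : twistedWeylGroup P Ω) (d : ℕ) :
    nonInversions b Ω (reducedBraid b Ω w ^ d) =
      (transport b (w : P.Aut))^[d] {i | b.IsPos i} := by
  induction d with
  | zero => exact nonInversions_one
  | succ d ih => rw [pow_succ, nonInversions_mul_reducedBraid, ih, Function.iterate_succ_apply']

lemma disjoint_transport_inversionSet (w : P.Aut) {S : Set ι} (hS : IsBiconvexSet b S) :
    Disjoint (transport b w S) (inversionSet b w) :=
  Set.disjoint_left.mpr fun _ hi hi' =>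
    hi'.2 ((hS.sumClosure_union (isBiconvexSet_inversionSet b w⁻¹)).isPos _ hi.2)

lemma RightDivides.trans {B : Type*} [Monoid B] {β γ δ : B} (h : RightDivides β γ)
    (h' : RightDivides γ δ) : RightDivides β δ := by
  obtain ⟨α, rfl⟩ := h
  obtain ⟨α', rfl⟩ := h'
  exact ⟨α' * α, (mul_assoc _ _ _).symm⟩

lemma RightDivides.mul_right {B : Type*} [Monoid B] {β γ : B} (h : RightDivides β γ) (δ : B) :
    RightDivides (β * δ) (γ * δ) := by
  obtain ⟨α, rfl⟩ := h
  exact ⟨α, mul_assoc _ _ _⟩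

/-- Acting last by `b_v` removes all inversions of `v`. Because the action is well defined on
braids, this bounds every reduced right divisor, whatever word represents `β`. -/
lemma RightDivides.inversionSet_subset {β : BraidMonoid b Ω} {v : twistedWeylGroup P Ω}
    (h : RightDivides (reducedBraid b Ω v) β) :
    inversionSet b v ⊆ {i | b.IsPos i} \ nonInversions b Ω β := by
  obtain ⟨α, rfl⟩ := h
  rw [nonInversions_mul_reducedBraid]
  have hdisj := disjoint_transport_inversionSet (v : P.Aut) (isBiconvexSet_nonInversions α)
  intro i hi
  exact ⟨hi.1, fun hi' => Set.disjoint_left.mp hdisj hi' hi⟩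

lemma reducedBraid_one : reducedBraid b Ω 1 = 1 :=
  PresentedMonoid.mk_eq_mk_of_rel .one

lemma reducedBraid_mul {x y : twistedWeylGroup P Ω}
    (h : length b ((x * y : twistedWeylGroup P Ω) : P.Aut) =
      length b (x : P.Aut) + length b (y : P.Aut)) :
    reducedBraid b Ω (x * y) = reducedBraid b Ω x * reducedBraid b Ω y :=
  (PresentedMonoid.mk_eq_mk_of_rel (.mul x y h)).symm

lemma rightDivides_reducedBraid {u x : twistedWeylGroup P Ω}
    (h : inversionSet b (u : P.Aut) ⊆ inversionSet b (x : P.Aut)) :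
    RightDivides (reducedBraid b Ω u) (reducedBraid b Ω x) := by
  refine ⟨reducedBraid b Ω (x * u⁻¹), ?_⟩
  rw [← reducedBraid_mul, inv_mul_cancel_right]
  rw [inv_mul_cancel_right]
  exact length_mul_inv_add h

variable [P.IsReduced]

lemma IsBiconvexSet.exists_twistedWeylGroup {S : Set ι} (hS : IsBiconvexSet b S) :
    ∃ u : twistedWeylGroup P Ω, (u : P.Aut) ∈ P.weylGroup ∧ inversionSet b (u : P.Aut) = S := by
  obtain ⟨u, hu, h⟩ := hS.exists_inversionSet_eq
  exact ⟨⟨u, le_sup_right (a := Ω) hu⟩, hu, h⟩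

/-- The element `q` inverts the complement of the closure used in `transport`. It is a right divisor
of `u` whose length adds to that of `y`, so `b_q b_y = b_{qy}` divides `β b_y`. As `y` may be
twisted, `v` is not required to lie in the Weyl group. -/
lemma exists_rightDivides_mul_reducedBraid {β : BraidMonoid b Ω} {u : twistedWeylGroup P Ω}
    (hu : RightDivides (reducedBraid b Ω u) β)
    (h : inversionSet b (u : P.Aut) = {i | b.IsPos i} \ nonInversions b Ω β)
    (y : twistedWeylGroup P Ω) :
    ∃ v : twistedWeylGroup P Ω, RightDivides (reducedBraid b Ω v) (β * reducedBraid b Ω y) ∧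
      inversionSet b (v : P.Aut) =
        {i | b.IsPos i} \ nonInversions b Ω (β * reducedBraid b Ω y) := by
  have hC := (isBiconvexSet_nonInversions β).sumClosure_union
    (isBiconvexSet_inversionSet b (y : P.Aut)⁻¹)
  obtain ⟨q, -, hq⟩ := hC.compl.exists_twistedWeylGroup (Ω := Ω)
  have hqu : inversionSet b (q : P.Aut) ⊆ inversionSet b (u : P.Aut) := by
    rw [hq, h]
    exact Set.sdiff_subset_sdiff_right fun i hi => .base (Or.inl hi)
  have hdisj : Disjoint (inversionSet b (q : P.Aut)) (inversionSet b (y : P.Aut)⁻¹) := by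
    rw [hq]
    exact Set.disjoint_left.mpr fun i hi hi' => hi.2 (.base (Or.inr hi'))
  refine ⟨q * y, ?_, ?_⟩
  · rw [reducedBraid_mul (length_mul_iff.mpr hdisj)]
    exact ((rightDivides_reducedBraid hqu).trans hu).mul_right _
  · rw [nonInversions_mul_reducedBraid]
    ext i
    by_cases hi : b.IsPos i
    · by_cases hy : b.IsPos ((y : P.Aut) • i)
      · rw [Subgroup.coe_mul, mem_inversionSet_mul_of_isPos hi hy, hq]
        simp [transport, hi, hy]
      · have hiy : i ∈ inversionSet b (y : P.Aut) := ⟨hi, hy⟩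
        refine iff_of_true ?_ ⟨hi, fun h' => hy (hC.isPos _ h'.2)⟩
        rw [Subgroup.coe_mul, mem_inversionSet_mul_of_mem hiy]
        exact fun h' => Set.disjoint_left.mp hdisj h' (negIdx_smul_mem_inversionSet_inv hiy)
    · exact iff_of_false (fun h => hi h.1) fun h => hi h.1

lemma exists_rightDivides_inversionSet_eq (β : BraidMonoid b Ω) :
    ∃ u : twistedWeylGroup P Ω, RightDivides (reducedBraid b Ω u) β ∧
      inversionSet b (u : P.Aut) = {i | b.IsPos i} \ nonInversions b Ω β := by
  have hβ : β ∈ Submonoid.closure (Set.range (PresentedMonoid.of (BraidRel b Ω))) := by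
    rw [PresentedMonoid.closure_range_of]; trivial
  induction hβ using Submonoid.closure_induction_right with
  | one =>
    refine ⟨1, ⟨1, by rw [reducedBraid_one, mul_one]⟩, ?_⟩
    rw [nonInversions_one, Set.sdiff_self]
    ext i
    simp [inversionSet]
  | mul_right β _ y hy ih =>
    obtain ⟨y, rfl⟩ := hy
    obtain ⟨u, hu, h⟩ := ih
    exact exists_rightDivides_mul_reducedBraid hu h y

/-- Reduced braids with equal inversion sets divide each other on the right, so a possibly twisted
divisor can be replaced by an untwisted one. -/
lemma isDGFactor_of_inversionSet_eq {β : BraidMonoid b Ω} {u : twistedWeylGroup P Ω}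
    (hu : (u : P.Aut) ∈ P.weylGroup)
    (h : inversionSet b (u : P.Aut) = {i | b.IsPos i} \ nonInversions b Ω β) :
    IsDGFactor b Ω β u := by
  obtain ⟨v, hv, hv'⟩ := exists_rightDivides_inversionSet_eq β
  refine ⟨hu, (rightDivides_reducedBraid (h.trans hv'.symm).le).trans hv, fun x _ hx => ?_⟩
  exact rightDivides_reducedBraid (h ▸ hx.inversionSet_subset)

lemma nonInversions_reducedBraid (u : twistedWeylGroup P Ω) :
    {i | b.IsPos i} \ nonInversions b Ω (reducedBraid b Ω u) = inversionSet b (u : P.Aut) := by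
  refine subset_antisymm (fun i hi => ?_) (RightDivides.inversionSet_subset ⟨1, by rw [one_mul]⟩)
  refine ⟨hi.1, fun hu => hi.2 ?_⟩
  rw [← one_mul (reducedBraid b Ω u), nonInversions_mul_reducedBraid, nonInversions_one]
  exact ⟨hi.1, .base (Or.inl hu)⟩

lemma inversionSet_DG (β : BraidMonoid b Ω) :
    ((DG b Ω β : twistedWeylGroup P Ω) : P.Aut) ∈ P.weylGroup ∧
      inversionSet b (DG b Ω β : P.Aut) = {i | b.IsPos i} \ nonInversions b Ω β := by
  obtain ⟨u, hu, h⟩ :=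
    (isBiconvexSet_nonInversions β).compl.exists_twistedWeylGroup (Ω := Ω)
  have hDG := isDGFactor_of_inversionSet_eq hu h
  have hex : ∃ u, IsDGFactor b Ω β u := ⟨u, hDG⟩
  rw [DG, dif_pos hex]
  obtain ⟨h1, h2, h3⟩ := hex.choose_spec
  refine ⟨h1, subset_antisymm h2.inversionSet_subset ?_⟩
  rw [← h, ← nonInversions_reducedBraid hex.choose]
  exact (h3 u hu hDG.2.1).inversionSet_subset

lemma inversionSet_pb {w : twistedWeylGroup P Ω} (hw : IsConvexElement b (w : P.Aut)) :
    ((pb b Ω w : twistedWeylGroup P Ω) : P.Aut) ∈ P.weylGroup ∧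
      inversionSet b (pb b Ω w : P.Aut) = unstablePositiveRoots b (w : P.Aut) := by
  have hex := (isBiconvexSet_unstablePositiveRoots hw).exists_twistedWeylGroup (Ω := Ω)
  rw [pb, dif_pos hex]
  exact hex.choose_spec

lemma DG_eq_pb_iff {w : twistedWeylGroup P Ω} (hw : IsConvexElement b (w : P.Aut))
    (β : BraidMonoid b Ω) :
    DG b Ω β = pb b Ω w ↔
      nonInversions b Ω β = {i | b.IsPos i} \ unstablePositiveRoots b (w : P.Aut) := by
  obtain ⟨h1, h2⟩ := inversionSet_DG β
  obtain ⟨h3, h4⟩ := inversionSet_pb hw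
  have hβ : nonInversions b Ω β ⊆ {i | b.IsPos i} := (isBiconvexSet_nonInversions β).isPos
  constructor
  · intro h
    rw [← h4, ← h, h2, Set.sdiff_sdiff_cancel_left hβ]
  · intro h
    refine Subtype.ext (eq_of_inversionSet_eq (b := b) h1 h3 ?_)
    rw [h2, h4, h, Set.sdiff_sdiff_cancel_left fun i hi => hi.1]

end Braid

/-! ### Chains of roots -/

/-- `AddReach P R i j` means that the root `j` is obtained from the root `i` by successively adding
roots in `R`, such that all intermediate sums are roots. -/
def AddReach (P : RootPairing ι K M N) (R : Set ι) : ι → ι → Prop :=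
  Relation.ReflTransGen fun i j => ∃ r ∈ R, P.root j = P.root i + P.root r

lemma AddReach.mem_of_isConvexSet {R S : Set ι} (hS : IsConvexSet P S) (hR : R ⊆ S) {i j : ι}
    (h : AddReach P R i j) (hi : i ∈ S) : j ∈ S := by
  induction h with
  | refl => exact hi
  | tail _ e ih =>
    obtain ⟨r, hr, e⟩ := e
    exact hS _ ih _ (hR hr) _ e

/-- Undoing the addition of `r` and applying `w⁻¹` adds `-w⁻¹ r`, which is an inversion of `w`. -/
lemma AddReach.reverse {b : P.Base} {w : P.Aut} {i j : ι}
    (h : AddReach P (inversionSet b w⁻¹) i j) :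
    AddReach P (inversionSet b w) (w⁻¹ • j) (w⁻¹ • i) := by
  induction h with
  | refl => exact .refl
  | tail _ e ih =>
    obtain ⟨r, hr, e⟩ := e
    refine Relation.ReflTransGen.head ⟨negIdx P (w⁻¹ • r), ?_, ?_⟩ ih
    · simpa using negIdx_smul_mem_inversionSet_inv hr
    · rw [root_smul_eq_add _ e, root_negIdx]; abel

section Finite

variable [Finite ι] [P.IsCrystallographic]

/-- If `x + y + r` is a root, so is `x + r` or `y + r`, say `z = x + r`. By induction `z` lies in
the closure, and is added to `y`, or in `R`, and the induction hypothesis for `y` applies to it. -/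
lemma mem_or_mem_sumClosure_of_add {b : P.Base} {R S : Set ι} (hR : ∀ i ∈ R, b.IsPos i)
    (hS : ∀ i ∈ S, b.IsPos i)
    (h : ∀ i ∈ S, ∀ r ∈ R, ∀ k, P.root k = P.root i + P.root r → k ∈ R ∪ S) {i : ι}
    (hi : i ∈ sumClosure P S) :
    ∀ r ∈ R, ∀ k, P.root k = P.root i + P.root r → k ∈ R ∪ sumClosure P S := by
  have hpos {i r : ι} (hi : i ∈ sumClosure P S) (hr : r ∈ R) : P.root i + P.root r ≠ 0 := by
    intro e
    have hip : b.IsPos i := sumClosure_subset (isConvexSet_isPos b) hS hi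
    have : i = negIdx P r := P.root.injective (by
      rw [root_negIdx]; exact eq_neg_of_add_eq_zero_left e)
    rw [this] at hip
    simp [hR r hr] at hip
  induction hi with
  | base hi => exact fun r hr k e => (h _ hi r hr k e).imp id .base
  | @add x y s hx hy e ihx ihy =>
    have key {x y r k z : ι} (hy : y ∈ sumClosure P S)
        (ihx : ∀ r ∈ R, ∀ k, P.root k = P.root x + P.root r → k ∈ R ∪ sumClosure P S)
        (ihy : ∀ r ∈ R, ∀ k, P.root k = P.root y + P.root r → k ∈ R ∪ sumClosure P S)
        (hr : r ∈ R) (hz : P.root z = P.root x + P.root r)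
        (hk : P.root k = P.root y + P.root z) : k ∈ R ∪ sumClosure P S := by
      rcases ihx r hr z hz with h' | h'
      · exact ihy z h' k hk
      · exact Or.inr (.add hy h' hk)
    intro r hr k hk
    rcases exists_root_eq_add_or (hpos hx hr) (hpos hy hr) e hk with ⟨z, hz⟩ | ⟨z, hz⟩
    · exact key hy ihx ihy hr hz (by rw [hk, hz, e]; abel)
    · exact key hx ihy ihx hr hz (by rw [hk, hz, e]; abel)

/-- In the closure under sums of `S ∪ R`, the roots which are not in `R` are sums of roots, not
in `R`, which are obtained from a single root of `S` by adding roots of `R`. -/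
lemma sumClosure_union_subset {b : P.Base} {R S : Set ι} (hR : ∀ i ∈ R, b.IsPos i)
    (hS : ∀ i ∈ S, b.IsPos i) (hRc : IsConvexSet P R) :
    sumClosure P (S ∪ R) ⊆ R ∪ sumClosure P ({j | ∃ i ∈ S, AddReach P R i j} \ R) := by
  set J := {j | ∃ i ∈ S, AddReach P R i j} \ R with hJ
  have hJpos : ∀ j ∈ J, b.IsPos j := by
    rintro j ⟨⟨i, hi, hij⟩, -⟩
    exact hij.mem_of_isConvexSet (isConvexSet_isPos b) hR (hS i hi)
  have key {i : ι} (hi : i ∈ sumClosure P J) := mem_or_mem_sumClosure_of_add hR hJpos (by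
    rintro j ⟨⟨i, hi, hij⟩, -⟩ r hr k e
    by_cases hk : k ∈ R
    · exact Or.inl hk
    · exact Or.inr ⟨⟨i, hi, hij.tail ⟨r, hr, e⟩⟩, hk⟩) hi
  refine sumClosure_subset ?_ ?_
  · rintro i (hi | hi) j (hj | hj) k e
    · exact Or.inl (hRc _ hi _ hj _ e)
    · exact key hj i hi k (by rw [e, add_comm])
    · exact key hi j hj k e
    · exact Or.inr (.add hi hj e)
  · rintro i (hi | hi)
    · by_cases hiR : i ∈ R
      · exact Or.inl hiR
      · exact Or.inr (.base ⟨⟨i, hi, .refl⟩, hiR⟩)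
    · exact Or.inl hi

/-- `IsChain b w d i j` means that there are positive roots `i = γ₀, …, γ_d = j` such that `w γₙ₊₁`
is obtained from `γₙ` by successively adding inversions of `w⁻¹`. -/
inductive IsChain (b : P.Base) (w : P.Aut) : ℕ → ι → ι → Prop
  | zero {i : ι} (hi : b.IsPos i) : IsChain b w 0 i i
  | succ {d : ℕ} {i j k : ι} (h : IsChain b w d i j) (hk : b.IsPos k)
      (hjk : AddReach P (inversionSet b w⁻¹) j (w • k)) : IsChain b w (d + 1) i k

lemma IsChain.isPos_right {b : P.Base} {w : P.Aut} {d : ℕ} {i j : ι} (h : IsChain b w d i j) :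
    b.IsPos j := by
  cases h <;> assumption

lemma IsChain.cons {b : P.Base} {w : P.Aut} {d : ℕ} {i j k : ι} (hi : b.IsPos i)
    (hij : AddReach P (inversionSet b w⁻¹) i (w • j)) (h : IsChain b w d j k) :
    IsChain b w (d + 1) i k := by
  induction h with
  | zero hj => exact .succ (.zero hi) hj hij
  | succ _ hk hjk ih => exact .succ (ih hij) hk hjk

lemma IsChain.reverse {b : P.Base} {w : P.Aut} {d : ℕ} {i j : ι} (h : IsChain b w d i j) :
    IsChain b w⁻¹ d j i := by
  induction h with
  | zero hi => exact .zero hi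
  | succ _ hk hjk ih => exact ih.cons hk (by simpa using hjk.reverse)

/-- For convex `w`, chains do not leave the set of unstable positive roots. -/
lemma IsChain.mem_unstablePositiveRoots {b : P.Base} {w : P.Aut} (hw : IsConvexElement b w)
    {d : ℕ} {i j : ι} (h : IsChain b w d i j) (hi : i ∈ unstablePositiveRoots b w) :
    j ∈ unstablePositiveRoots b w := by
  induction h with
  | zero => exact hi
  | succ _ hk hjk ih =>
    have hsub := inversionSet_subset_unstablePositiveRoots b w⁻¹
    rw [unstablePositiveRoots_inv] at hsub
    refine ⟨hk, fun hs => ?_⟩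
    exact (hjk.mem_of_isConvexSet hw hsub (ih hi)).2 ((smul_mem_stableRoots_iff b w _).mpr hs)

lemma IsChain.mem_iterate_transport {b : P.Base} {w : P.Aut} {d : ℕ} {i j : ι}
    (h : IsChain b w d i j) : j ∈ (transport b w)^[d] {i | b.IsPos i} := by
  induction h with
  | zero hi => exact hi
  | succ _ hk hjk ih =>
    rw [Function.iterate_succ_apply']
    refine ⟨hk, hjk.mem_of_isConvexSet (isConvexSet_sumClosure _) ?_ (.base (Or.inl ih))⟩
    exact fun r hr => .base (Or.inr hr)

/-- By `sumClosure_union_subset`, `w k` is an inversion of `w⁻¹`, impossible for positive `k`, or a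
sum of non-inversions reached from chain endpoints. Applying `w⁻¹` makes these endpoints of chains
one step longer. -/
lemma iterate_transport_subset (b : P.Base) (w : P.Aut) (d : ℕ) :
    (transport b w)^[d] {i | b.IsPos i} ⊆ sumClosure P {j | ∃ i, IsChain b w d i j} := by
  induction d with
  | zero => exact fun i hi => .base ⟨i, .zero hi⟩
  | succ d ih =>
    rw [Function.iterate_succ_apply']
    intro k hk
    have h1 : w • k ∈ sumClosure P ({j | ∃ i, IsChain b w d i j} ∪ inversionSet b w⁻¹) :=
      sumClosure_subset (isConvexSet_sumClosure _) (Set.union_subset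
        (ih.trans (sumClosure_mono Set.subset_union_left))
        (Set.subset_union_right.trans (subset_sumClosure _))) hk.2
    have hbi := isBiconvexSet_inversionSet b w⁻¹
    rcases sumClosure_union_subset hbi.isPos (fun j hj => hj.choose_spec.isPos_right) hbi.convex h1
      with h2 | h2
    · exact (h2.2 (by simpa using hk.1)).elim
    · have h3 : w • k ∈ {j | w⁻¹ • j ∈ sumClosure P {j | ∃ i, IsChain b w (d + 1) i j}} := by
        refine sumClosure_subset (isConvexSet_preimage_smul _ (isConvexSet_sumClosure _)) ?_ h2
        rintro j ⟨⟨i, ⟨i₀, hi⟩, hij⟩, hj⟩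
        have hjp : b.IsPos j := hij.mem_of_isConvexSet (isConvexSet_isPos b) hbi.isPos hi.isPos_right
        have hjp' : b.IsPos (w⁻¹ • j) := by by_contra h'; exact hj ⟨hjp, h'⟩
        exact .base ⟨i₀, .succ hi hjp' (by rwa [smul_inv_smul])⟩
      simpa using h3

lemma subset_iterate_transport (b : P.Base) (w : P.Aut) (d : ℕ) :
    {i | b.IsPos i} \ unstablePositiveRoots b w ⊆ (transport b w)^[d] {i | b.IsPos i} := by
  induction d with
  | zero => exact Set.sdiff_subset
  | succ d ih =>
    rw [Function.iterate_succ_apply']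
    exact fun i hi => ⟨hi.1, .base (Or.inl (ih (smul_mem_diff_unstablePositiveRoots hi)))⟩

lemma iterate_transport_eq_inv {b : P.Base} {w : P.Aut} (hw : IsConvexElement b w) {d : ℕ}
    (h : (transport b w)^[d] {i | b.IsPos i} = {i | b.IsPos i} \ unstablePositiveRoots b w) :
    (transport b w⁻¹)^[d] {i | b.IsPos i} = {i | b.IsPos i} \ unstablePositiveRoots b w := by
  refine subset_antisymm ?_ ?_
  swap
  · rw [← unstablePositiveRoots_inv]
    exact subset_iterate_transport b w⁻¹ d
  refine (iterate_transport_subset b w⁻¹ d).trans (sumClosure_subset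
    (isBiconvexSet_unstablePositiveRoots hw).compl.convex ?_)
  rintro j ⟨i, hij⟩
  refine ⟨hij.isPos_right, fun hj => ?_⟩
  -- Reversal turns a `w⁻¹`-chain ending at the unstable `j` into a `w`-chain starting there. Its
  -- endpoint `i` is unstable by convexity, yet lies in the iterate for `w`.
  have hji : IsChain b w d j i := by simpa using hij.reverse
  have hi := hji.mem_iterate_transport
  rw [h] at hi
  exact hi.2 (hji.mem_unstablePositiveRoots hw hj)

end Finite

end TwistedWeyl

theorem corollaryA {ι K M N : Type*} [Finite ι] [Field K] [CharZero K]
    [AddCommGroup M] [Module K M] [AddCommGroup N] [Module K N]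
    (P : RootPairing ι K M N) [P.IsRootSystem] [P.IsCrystallographic] [P.IsReduced]
    (b : P.Base) (Ω : Subgroup P.Aut) (hΩ : Ω ≤ TwistedWeyl.twistGroup b)
    (w : TwistedWeyl.twistedWeylGroup P Ω)
    (hw : TwistedWeyl.IsConvexElement b (w : P.Aut)) (d : ℕ) :
    TwistedWeyl.DG b Ω (TwistedWeyl.reducedBraid b Ω w ^ d) = TwistedWeyl.pb b Ω w ↔
      TwistedWeyl.DG b Ω (TwistedWeyl.reducedBraid b Ω w⁻¹ ^ d) = TwistedWeyl.pb b Ω w := by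
  rw [TwistedWeyl.DG_eq_pb_iff hw, TwistedWeyl.DG_eq_pb_iff hw,
    TwistedWeyl.nonInversions_reducedBraid_pow, TwistedWeyl.nonInversions_reducedBraid_pow,
    Subgroup.coe_inv]
  refine ⟨TwistedWeyl.iterate_transport_eq_inv hw, fun h => ?_⟩
  have hw' : TwistedWeyl.IsConvexElement b (w : P.Aut)⁻¹ := by
    rwa [TwistedWeyl.IsConvexElement, TwistedWeyl.unstablePositiveRoots_inv]
  rw [← TwistedWeyl.unstablePositiveRoots_inv] at h ⊢
  simpa using TwistedWeyl.iterate_transport_eq_inv hw' h
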